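/- Let $\ell_1$ be the complex Banach space of absolutely summable sequences $(x(n))_{n\in\mathbb N}$, let $B_{\ell_1}$ be its open unit ball, and let $\ell_1'$ and $\ell_1''$ denote its dual and bidual. Let $\mathcal A_u(B_{\ell_1})$ be the algebra of all uniformly continuous holomorphic functions $f:B_{\ell_1}\to\mathbb C$ with the norm $\|f\|=\sup_{x\in B_{\ell_1}}|f(x)|$, and let $\mathcal M(\mathcal A_u(B_{\ell_1}))$ be its spectrum, that is, the set of all nonzero multiplicative continuous linear functionals on $\mathcal A_u(B_{\ell_1})$. For $z''\in\ell_1''$ with $\|z''\|\le 1$, the fiber over $z''$ is $$\mathcal M_{z''}=\{\varphi\in\mathcal M(\mathcal A_u(B_{\ell_1})) : \varphi(x'|_{B_{\ell_1}})=z''(x')\ \text{ for all } x'\in \ell_1'\}.$$ The Gleason part of $\varphi\in\mathcal M(\mathcal A_u(B_{\ell_1}))$ is $\mathcal{GP}(\varphi)=\{\psi\in\mathcal M(\mathcal A_u(B_{\ell_1})) : \|\varphi-\psi\|<2\}$, where $\|\varphi-\psi\|=\sup\{|\varphi(f)-\psi(f)| : f\in\mathcal A_u(B_{\ell_1}),\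 \|f\|\le 1\}$. **Theorem.** For every $z''\in\ell_1''$ with $\|z''\|<1$, the fiber $\mathcal M_{z''}$ intersects exactly $2^{\mathfrak c}$ different Gleason parts of $\mathcal M(\mathcal A_u(B_{\ell_1}))$, where $\mathfrak c$ is the cardinality of the continuum; that is, the set $\{\mathcal{GP}(\varphi) : \varphi\in\mathcal M(\mathcal A_u(B_{\ell_1})),\ \mathcal{GP}(\varphi)\cap\mathcal M_{z''}\neq\emptyset\}$ has cardinality $2^{\mathfrak c}$. -/

import Mathlib

open scoped BoundedContinuousFunction

noncomputable section

namespace BallAlgebra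

/-- The open unit ball `B_X` of a complex normed space. -/
abbrev unitBall (X : Type*) [NormedAddCommGroup X] [NormedSpace ℂ X] : Set X :=
  Metric.ball (0 : X) 1

/-- `f : B_X → ℂ` is holomorphic: around every point of `B_X` it is given by a convergent power
series of continuous homogeneous polynomials. The function `F` only serves to regard `f` as
defined on `X`; its values outside `B_X` play no role. -/
def IsHolomorphic {X : Type*} [NormedAddCommGroup X] [NormedSpace ℂ X]
    (f : unitBall X → ℂ) : Prop :=
  ∃ F : X → ℂ, AnalyticOnNhd ℂ F (unitBall X) ∧ ∀ x : unitBall X, F x = f x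

/-- The uniformly continuous holomorphic functions on `B_X`, as a subalgebra of the bounded
continuous functions. (A uniformly continuous function on `B_X` is automatically bounded, so
realizing the algebra inside the bounded continuous functions loses nothing.) -/
def AuSubalgebra (X : Type*) [NormedAddCommGroup X] [NormedSpace ℂ X] :
    Subalgebra ℂ (unitBall X →ᵇ ℂ) where
  carrier := {f | UniformContinuous f ∧ IsHolomorphic f}
  mul_mem' := by
    rintro f g ⟨hf, F, hF, hFf⟩ ⟨hg, G, hG, hGg⟩
    refine ⟨?_, F * G, hF.mul hG, fun x => by simp [hFf, hGg]⟩
    rw [Metric.uniformContinuous_iff]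
    intro ε hε
    have hC : 0 < ‖f‖ + ‖g‖ + 1 := by positivity
    obtain ⟨d₁, hd₁, h₁⟩ := Metric.uniformContinuous_iff.1 hf (ε / (‖f‖ + ‖g‖ + 1)) (by positivity)
    obtain ⟨d₂, hd₂, h₂⟩ := Metric.uniformContinuous_iff.1 hg (ε / (‖f‖ + ‖g‖ + 1)) (by positivity)
    refine ⟨min d₁ d₂, lt_min hd₁ hd₂, fun {a b} hab => ?_⟩
    have e₁ := h₁ (lt_of_lt_of_le hab (min_le_left _ _))
    have e₂ := h₂ (lt_of_lt_of_le hab (min_le_right _ _))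
    rw [dist_eq_norm] at e₁ e₂ ⊢
    set t := ε / (‖f‖ + ‖g‖ + 1) with ht
    have ht0 : 0 < t := by positivity
    have hte : t * (‖f‖ + ‖g‖ + 1) = ε := div_mul_cancel₀ _ hC.ne'
    have e : (f * g) a - (f * g) b = f a * (g a - g b) + (f a - f b) * g b := by
      simp only [BoundedContinuousFunction.coe_mul, Pi.mul_apply]; ring
    rw [e]
    calc ‖f a * (g a - g b) + (f a - f b) * g b‖
        ≤ ‖f a‖ * ‖g a - g b‖ + ‖f a - f b‖ * ‖g b‖ := by
          refine (norm_add_le _ _).trans ?_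
          rw [norm_mul, norm_mul]
      _ ≤ ‖f‖ * t + t * ‖g‖ := by
          gcongr
          · exact f.norm_coe_le_norm a
          · exact g.norm_coe_le_norm b
      _ < t * (‖f‖ + ‖g‖ + 1) := by linarith
      _ = ε := hte
  add_mem' := by
    rintro f g ⟨hf, F, hF, hFf⟩ ⟨hg, G, hG, hGg⟩
    exact ⟨hf.add hg, F + G, hF.add hG, fun x => by simp [hFf, hGg]⟩
  algebraMap_mem' := fun c =>
    ⟨uniformContinuous_const, fun _ => c, analyticOnNhd_const, fun _ => rfl⟩

/-- The algebra `𝒜_u(B_X)` of uniformly continuous holomorphic functions on `B_X`, with the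
pointwise operations and the supremum norm. -/
def Au (X : Type*) [NormedAddCommGroup X] [NormedSpace ℂ X] : Type _ := AuSubalgebra X

instance (X : Type*) [NormedAddCommGroup X] [NormedSpace ℂ X] : NormedCommRing (Au X) :=
  inferInstanceAs (NormedCommRing (AuSubalgebra X))

instance (X : Type*) [NormedAddCommGroup X] [NormedSpace ℂ X] : NormedAlgebra ℂ (Au X) :=
  inferInstanceAs (NormedAlgebra ℂ (AuSubalgebra X))

instance (X : Type*) [NormedAddCommGroup X] [NormedSpace ℂ X] : FunLike (Au X) (unitBall X) ℂ where
  coe f := f.1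
  coe_injective := fun _ _ h => Subtype.ext (DFunLike.coe_injective h)

/-- The restriction to `B_X` of a continuous linear functional `x' ∈ X'`, as an element of
`𝒜_u(B_X)`. -/
def ofDual {X : Type*} [NormedAddCommGroup X] [NormedSpace ℂ X] (x' : StrongDual ℂ X) : Au X :=
  ⟨BoundedContinuousFunction.ofNormedAddCommGroup (fun x : unitBall X => x' x)
      (x'.continuous.comp continuous_subtype_val) ‖x'‖ (fun x => by
        have hx : ‖(x : X)‖ ≤ 1 := (mem_ball_zero_iff.1 x.2).le
        exact x'.le_of_opNorm_le_of_le le_rfl hx |>.trans (by rw [mul_one])),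
    x'.uniformContinuous.comp uniformContinuous_subtype_val,
    x', x'.analyticOnNhd _, fun _ => rfl⟩

/-- The spectrum `ℳ(𝒜_u(B_X))`: nonzero multiplicative continuous linear functionals. -/
abbrev Spectrum (X : Type*) [NormedAddCommGroup X] [NormedSpace ℂ X] : Type _ :=
  WeakDual.characterSpace ℂ (Au X)

/-- The fiber `ℳ_z` over a point `z` of the bidual `X''`: all `φ` in the spectrum whose
restriction to `X'` is `z`. -/
def fiber {X : Type*} [NormedAddCommGroup X] [NormedSpace ℂ X]
    (z : StrongDual ℂ (StrongDual ℂ X)) : Set (Spectrum X) :=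
  {φ | ∀ x' : StrongDual ℂ X, φ (ofDual x') = z x'}

/-- The Gleason part `𝒢𝒫(φ) = {ψ : ‖φ - ψ‖ < 2}`, with the norm of the dual of `𝒜_u(B_X)`. -/
def gleasonPart {X : Type*} [NormedAddCommGroup X] [NormedSpace ℂ X]
    (φ : Spectrum X) : Set (Spectrum X) :=
  {ψ | ‖WeakDual.CharacterSpace.toCLM φ - WeakDual.CharacterSpace.toCLM ψ‖ < 2}

/-- The collection of all Gleason parts of `ℳ(𝒜_u(B_X))`. -/
def gleasonParts (X : Type*) [NormedAddCommGroup X] [NormedSpace ℂ X] : Set (Set (Spectrum X)) :=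
  Set.range gleasonPart

/-- The complex sequence space `ℓ₁`. -/
abbrev EllOne : Type := lp (fun _ : ℕ => ℂ) 1

end BallAlgebra

end

noncomputable section

namespace BallAlgebra

open Filter Topology

/-! The upper bound is a count. `EllOne` is separable, so its algebra has at most 𝔠 elements and its
spectrum at most 𝔠^𝔠 = 2^𝔠 (`mk_spectrum_le`).

For the lower bound, each of the 2^𝔠 nonprincipal ultrafilters U on ℕ gives a character in the
fiber, and distinct U give characters at distance 2. Put s = 1 - ‖z‖. The character is a limit of
evaluations at p + (t/2)(e_{a m} - e_{a n}), where p → z weak-star with ‖p‖ ≤ ‖z‖, t → s, and m ≠ n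
both tend along U (`exists_mem_fiber_quadEstimate`). Linear functionals lose the difference in the
limit, but `signForm`, of norm at most 1, equals t² on the added vector.

To separate U from V, the sequence `a` is chosen so that z has almost no mass on its tails
(`exists_strictMono_variationLE`). Off a tail some functional x' almost norms z; on the tail a form
q, weighted by 1 and by a unimodular η, has values near s² and (sη)². If k : 2l is close to ‖z‖ : s,
then x'^k q^l is bounded by nearly ‖z‖^k s^{2l} on the ball (`exists_monomial_bound`). With η^{2l} =
-1 the two characters take nearly opposite values of nearly that modulus (`two_le_norm_sub`). -/

namespace EllOne

/-! ### Diagonal operators and a quadratic form on ℓ₁. -/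

theorem hasSum_norm (x : EllOne) : HasSum (fun i => ‖x i‖) ‖x‖ := by
  simpa using lp.hasSum_norm (p := 1) (by simp) x

theorem summable_norm (x : EllOne) : Summable fun i => ‖x i‖ := (hasSum_norm x).summable

theorem norm_eq_tsum (x : EllOne) : ‖x‖ = ∑' i, ‖x i‖ := (hasSum_norm x).tsum_eq.symm

theorem summable_norm_mul {u : ℕ → ℂ} {C : ℝ} (hu : ∀ j, ‖u j‖ ≤ C) (x : EllOne) :
    Summable fun i => ‖u i * x i‖ :=
  Summable.of_nonneg_of_le (fun _ => norm_nonneg _)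
    (fun i => (norm_mul_le _ _).trans (mul_le_mul_of_nonneg_right (hu i) (norm_nonneg _)))
    ((summable_norm x).mul_left C)

/-- Multiplication by a sequence bounded by `1`, as an operator on `ℓ₁`. -/
def diag (u : ℕ → ℂ) (hu : ∀ j, ‖u j‖ ≤ 1) : EllOne →L[ℂ] EllOne :=
  LinearMap.mkContinuous
    { toFun := fun x => ⟨fun j => u j * x j, memℓp_gen (by simpa using summable_norm_mul hu x)⟩
      map_add' := fun x y => by ext j; exact mul_add (u j) (x j) (y j)
      map_smul' := fun c x => by ext j; exact mul_left_comm (u j) c (x j) }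
    1 (fun x => by
      rw [one_mul, norm_eq_tsum, norm_eq_tsum]
      refine Summable.tsum_le_tsum (fun i => ?_) (summable_norm_mul hu x) (summable_norm x)
      exact (norm_mul_le _ _).trans (mul_le_of_le_one_left (norm_nonneg _) (hu i)))

@[simp] theorem diag_apply (u : ℕ → ℂ) (hu : ∀ j, ‖u j‖ ≤ 1) (x : EllOne) (j : ℕ) :
    diag u hu x j = u j * x j := rfl

/-- The ℓ₁ norm is additive over coordinates. This is the source of every constraint a + b ≤ 1
below. -/
theorem norm_diag_add_norm_diag_le {u v : ℕ → ℂ} (hu : ∀ j, ‖u j‖ ≤ 1) (hv : ∀ j, ‖v j‖ ≤ 1)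
    (huv : ∀ j, ‖u j‖ + ‖v j‖ ≤ 1) (x : EllOne) : ‖diag u hu x‖ + ‖diag v hv x‖ ≤ ‖x‖ := by
  rw [norm_eq_tsum, norm_eq_tsum, norm_eq_tsum,
    ← (summable_norm (diag u hu x)).tsum_add (summable_norm (diag v hv x))]
  refine Summable.tsum_le_tsum (fun i => ?_)
    ((summable_norm (diag u hu x)).add (summable_norm (diag v hv x))) (summable_norm x)
  simp only [diag_apply, norm_mul, ← add_mul]
  exact mul_le_of_le_one_left (norm_nonneg _) (huv i)

theorem norm_diag_le {u : ℕ → ℂ} (hu : ∀ j, ‖u j‖ ≤ 1) (x : EllOne) : ‖diag u hu x‖ ≤ ‖x‖ := by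
  have h0 : ∀ _ : ℕ, ‖(0 : ℂ)‖ ≤ 1 := by simp
  have := norm_diag_add_norm_diag_le hu h0 (by simpa using hu) x
  linarith [norm_nonneg (diag (fun _ => 0) h0 x)]

/-- The unit vectors of `ℓ₁`. -/
def unitVec (n : ℕ) : EllOne := lp.single 1 n 1

theorem unitVec_apply (n j : ℕ) : unitVec n j = if j = n then 1 else 0 := by
  simp [unitVec, lp.single_apply, Pi.single_apply]

theorem norm_unitVec (n : ℕ) : ‖unitVec n‖ = 1 := by
  simp [unitVec, lp.norm_single]

theorem diag_unitVec {u : ℕ → ℂ} (hu : ∀ j, ‖u j‖ ≤ 1) (n : ℕ) :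
    diag u hu (unitVec n) = u n • unitVec n := by
  ext j
  simp only [diag_apply, unitVec_apply, lp.coeFn_smul, Pi.smul_apply, smul_eq_mul]
  split_ifs with h <;> simp [h]

/-- The sum of the coordinates. -/
def coordSum : EllOne →L[ℂ] ℂ := lp.tsumCLM (𝕜 := ℂ) (α := ℕ) (E := ℂ)

theorem norm_coordSum_le (x : EllOne) : ‖coordSum x‖ ≤ ‖x‖ := lp.norm_tsum_le x

theorem coordSum_unitVec (n : ℕ) : coordSum (unitVec n) = 1 := by
  simp [coordSum, unitVec_apply]

/-- Up to sign, the left side is the coordinate sum of y after flipping coordinate j. Hence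
`signForm` has norm at most 1. -/
theorem norm_two_mul_sub_coordSum_le (y : EllOne) (j : ℕ) : ‖2 * y j - coordSum y‖ ≤ ‖y‖ := by
  have hu : ∀ k, ‖(if k = j then -1 else 1 : ℂ)‖ ≤ 1 := fun k => by split_ifs <;> simp
  have h : diag (fun k => if k = j then -1 else 1) hu y = y - (2 * y j) • unitVec j := by
    ext k
    simp only [diag_apply, lp.coeFn_sub, lp.coeFn_smul, Pi.sub_apply, Pi.smul_apply, smul_eq_mul,
      unitVec_apply]
    split_ifs with h
    · subst h; ring
    · ring
  have h' : coordSum (diag (fun k => if k = j then -1 else 1) hu y) = coordSum y - 2 * y j := by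
    rw [h, map_sub, map_smul, coordSum_unitVec]; simp
  rw [norm_sub_rev, ← h']
  exact (norm_coordSum_le _).trans (norm_diag_le hu y)

theorem summable_signForm (x y : EllOne) : Summable fun j => (2 * y j - coordSum y) * x j :=
  (summable_norm_mul (norm_two_mul_sub_coordSum_le y) x).of_norm

/-- The symmetric bilinear form on `ℓ₁` whose matrix has entries `1` on the diagonal and `-1`
elsewhere. -/
def signForm : EllOne →L[ℂ] EllOne →L[ℂ] ℂ :=
  LinearMap.mkContinuous₂
    (LinearMap.mk₂ ℂ (fun x y : EllOne => ∑' j, (2 * y j - coordSum y) * x j)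
      (fun x x' y => by
        rw [← (summable_signForm x y).tsum_add (summable_signForm x' y)]
        exact tsum_congr fun j => mul_add _ _ _)
      (fun c x y => by
        rw [smul_eq_mul, ← tsum_mul_left]
        exact tsum_congr fun j => mul_left_comm _ _ _)
      (fun x y y' => by
        rw [← (summable_signForm x y).tsum_add (summable_signForm x y')]
        refine tsum_congr fun j => ?_
        rw [map_add, lp.coeFn_add, Pi.add_apply]
        ring)
      (fun c x y => by
        rw [smul_eq_mul, ← tsum_mul_left]
        refine tsum_congr fun j => ?_
        rw [map_smul, lp.coeFn_smul, Pi.smul_apply, smul_eq_mul, smul_eq_mul]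
        ring))
    1 (fun x y => by
      have hs := summable_norm_mul (norm_two_mul_sub_coordSum_le y) x
      rw [LinearMap.mk₂_apply, one_mul, mul_comm, norm_eq_tsum x, ← tsum_mul_left]
      refine (norm_tsum_le_tsum_norm hs).trans ?_
      refine Summable.tsum_le_tsum (fun i => ?_) hs ((summable_norm x).mul_left _)
      rw [norm_mul]
      exact mul_le_mul_of_nonneg_right (norm_two_mul_sub_coordSum_le y i) (norm_nonneg _))

theorem signForm_apply (x y : EllOne) :
    signForm x y = ∑' j, (2 * y j - coordSum y) * x j := rfl

theorem norm_signForm_le (x y : EllOne) : ‖signForm x y‖ ≤ ‖x‖ * ‖y‖ := by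
  refine (signForm.le_opNorm₂ x y).trans ?_
  gcongr
  refine mul_le_of_le_one_left (norm_nonneg _) ?_
  exact LinearMap.mkContinuous₂_norm_le _ zero_le_one _

theorem signForm_unitVec (m n : ℕ) : signForm (unitVec m) (unitVec n) = if m = n then 1 else -1 := by
  rw [signForm_apply, tsum_eq_single m]
  · simp only [unitVec_apply, coordSum_unitVec, if_true]
    split_ifs <;> norm_num
  · intro j hj; simp [unitVec_apply, hj]

/-- As e_m - e_n has norm 2, the form attains its norm bound here; no constant is lost in the final
distance. -/
theorem signForm_unitVec_sub {m n : ℕ} (h : m ≠ n) :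
    signForm (unitVec m - unitVec n) (unitVec m - unitVec n) = 4 := by
  simp only [map_sub, sub_apply, signForm_unitVec, h, h.symm, if_true, if_false]
  norm_num

theorem norm_signForm_self_sub_le (x y : EllOne) (hx : ‖x‖ ≤ 1) (hy : ‖y‖ ≤ 1) :
    ‖signForm x x - signForm y y‖ ≤ 2 * ‖x - y‖ := by
  have h : signForm x x - signForm y y = signForm x (x - y) + signForm (x - y) y := by
    simp only [map_sub, sub_apply]; ring
  rw [h]
  refine (norm_add_le _ _).trans ?_
  have h1 := norm_signForm_le x (x - y)
  have h2 := norm_signForm_le (x - y) y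
  nlinarith [norm_nonneg (x - y), norm_nonneg x, norm_nonneg y]

instance : TopologicalSpace.SeparableSpace EllOne := by
  have hs : TopologicalSpace.IsSeparable (closure (Submodule.span ℂ (Set.range unitVec) : Set EllOne)) :=
    ((Set.countable_range unitVec).isSeparable.span (R := ℂ)).closure
  have : closure (Submodule.span ℂ (Set.range unitVec) : Set EllOne) = Set.univ := by
    refine Set.eq_univ_of_forall fun x => ?_
    have hx := lp.hasSum_single (p := 1) (by simp) x
    refine mem_closure_of_tendsto hx (Eventually.of_forall fun s => ?_)
    refine Submodule.sum_mem _ fun i _ => ?_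
    have : lp.single 1 i (x i) = x i • unitVec i := by
      rw [unitVec, ← lp.single_smul]; simp
    rw [this]
    exact Submodule.smul_mem _ _ (Submodule.subset_span ⟨i, rfl⟩)
  rw [this] at hs
  exact TopologicalSpace.isSeparable_univ_iff.1 hs

end EllOne

/-! ### Characters as limits of evaluations, cardinality of the spectrum, Goldstine. -/

section General

variable {X : Type*} [NormedAddCommGroup X] [NormedSpace ℂ X]

@[simp] theorem Au.mul_apply (f g : Au X) (x : unitBall X) : (f * g) x = f x * g x := rfl

@[simp] theorem Au.one_apply (x : unitBall X) : (1 : Au X) x = 1 := rfl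

@[simp] theorem Au.pow_apply (f : Au X) (n : ℕ) (x : unitBall X) : (f ^ n) x = f x ^ n := by
  induction n with
  | zero => simp
  | succ n ih => simp [pow_succ, ih]

@[simp] theorem ofDual_apply (x' : StrongDual ℂ X) (x : unitBall X) : ofDual x' x = x' x := rfl

theorem Au.norm_apply_le (f : Au X) (x : unitBall X) : ‖f x‖ ≤ ‖f‖ :=
  BoundedContinuousFunction.norm_coe_le_norm f.1 x

theorem Au.norm_le {f : Au X} {C : ℝ} (hC : 0 ≤ C) (h : ∀ x, ‖f x‖ ≤ C) : ‖f‖ ≤ C :=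
  (BoundedContinuousFunction.norm_le (f := f.1) hC).2 h

/-- Evaluation at a point of the ball. -/
def evalAt (x : unitBall X) : Spectrum X :=
  ⟨StrongDual.toWeakDual (LinearMap.mkContinuous
      { toFun := fun f : Au X => f x, map_add' := fun _ _ => rfl, map_smul' := fun _ _ => rfl } 1
      (fun f => (f.norm_apply_le x).trans_eq (one_mul _).symm)),
    fun h => one_ne_zero (α := ℂ) (DFunLike.congr_fun h (1 : Au X)), fun _ _ => rfl⟩

/-- Banach–Alaoglu: evaluations lie in the dual unit ball, and the characters of a unital algebra
form a weak-star closed set. -/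
theorem exists_tendsto_of_ultrafilter {ι : Type*} (W : Ultrafilter ι) (p : ι → unitBall X) :
    ∃ φ : Spectrum X, ∀ f : Au X, Tendsto (fun i => f (p i)) W (𝓝 (φ f)) := by
  have hK : IsCompact (WeakDual.characterSpace ℂ (Au X) ∩
      WeakDual.toStrongDual ⁻¹' Metric.closedBall (0 : StrongDual ℂ (Au X)) 1) :=
    (WeakDual.isCompact_closedBall 0 1).inter_left WeakDual.CharacterSpace.isClosed
  obtain ⟨φ, hφ, hle⟩ := hK.ultrafilter_le_nhds'
    (W.map fun i => (evalAt (p i) : WeakDual ℂ (Au X))) (by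
      refine Filter.mem_map.2 (Filter.univ_mem' fun i => ⟨(evalAt (p i)).2, ?_⟩)
      rw [Set.mem_preimage, mem_closedBall_zero_iff]
      exact ContinuousLinearMap.opNorm_le_bound _ zero_le_one
        fun f => (f.norm_apply_le (p i)).trans_eq (one_mul _).symm)
  refine ⟨⟨φ, hφ.1⟩, fun f => ?_⟩
  exact ((WeakDual.eval_continuous f).tendsto φ).comp hle

/-- An element of the algebra is determined by its values on a countable dense set, and a character
by its values on the algebra. -/
theorem mk_spectrum_le {X : Type} [NormedAddCommGroup X] [NormedSpace ℂ X]
    [TopologicalSpace.SeparableSpace X] :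
    Cardinal.mk (Spectrum X) ≤ 2 ^ Cardinal.continuum := by
  have hA : Cardinal.mk (Au X) ≤ Cardinal.continuum := by
    have : Nonempty (unitBall X) := ⟨⟨0, by simp⟩⟩
    have : TopologicalSpace.SeparableSpace (unitBall X) :=
      (Metric.isOpen_ball (x := (0 : X)) (ε := 1)).isOpenEmbedding_subtypeVal.separableSpace
    have hinj : Function.Injective
        fun (f : Au X) (n : ℕ) => f (TopologicalSpace.denseSeq (unitBall X) n) := by
      intro f g h
      refine DFunLike.coe_injective ?_
      exact (TopologicalSpace.denseRange_denseSeq (unitBall X)).equalizer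
        f.1.continuous g.1.continuous h
    refine (Cardinal.mk_le_of_injective hinj).trans ?_
    simp [Cardinal.mk_complex]
  have hinj : Function.Injective fun (φ : Spectrum X) (f : Au X) => φ f :=
    fun φ ψ h => WeakDual.CharacterSpace.ext fun f => congrFun h f
  refine (Cardinal.mk_le_of_injective hinj).trans ?_
  rw [← Cardinal.power_def, Cardinal.mk_complex]
  calc Cardinal.continuum ^ Cardinal.mk (Au X)
      ≤ Cardinal.continuum ^ Cardinal.continuum :=
        Cardinal.power_le_power_left Cardinal.continuum_ne_zero hA
    _ = 2 ^ Cardinal.continuum := by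
        rw [Cardinal.power_self_eq Cardinal.aleph0_le_continuum]

/-- Goldstine's theorem for finitely many functionals. -/
theorem exists_forall_norm_sub_lt (z : StrongDual ℂ (StrongDual ℂ X)) (S : Finset (StrongDual ℂ X))
    {ε : ℝ} (hε : 0 < ε) : ∃ x : X, ‖x‖ ≤ ‖z‖ ∧ ∀ x' ∈ S, ‖x' x - z x'‖ < ε := by
  classical
  let T : X →L[ℂ] (S → ℂ) := ContinuousLinearMap.pi fun x' => (x' : StrongDual ℂ X)
  let w : S → ℂ := fun x' => z x'
  let K : Set (S → ℂ) := closure (T '' Metric.closedBall 0 ‖z‖)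
  have hK : w ∈ K := by
    by_contra hw
    have hconv : Convex ℝ K := by
      refine Convex.closure ?_
      exact (convex_closedBall (0 : X) ‖z‖).is_linear_image
        ⟨fun a b => map_add T a b, fun c a => (T.restrictScalars ℝ).map_smul c a⟩
    obtain ⟨g, b, hg, hb⟩ :=
      RCLike.geometric_hahn_banach_closed_point (𝕜 := ℂ) hconv isClosed_closure hw
    let x' : StrongDual ℂ X := g.comp T
    -- The separating functional lies in the span of S, so z acts on it through the vector w alone.
    have hx' : x' = ∑ i : S, g (Pi.single i 1) • (i : StrongDual ℂ X) := by
      ext x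
      have : T x = ∑ i : S, (i : StrongDual ℂ X) x • (Pi.single i 1 : S → ℂ) := by
        ext j
        simp [T, Finset.sum_apply, Pi.single_apply]
      simp only [x', ContinuousLinearMap.comp_apply, this, map_sum, map_smul,
        sum_apply, smul_apply, smul_eq_mul]
      exact Finset.sum_congr rfl fun i _ => mul_comm _ _
    have hgw : g w = z x' := by
      have : w = ∑ i : S, z i • (Pi.single i 1 : S → ℂ) := by
        ext j
        simp [w, Finset.sum_apply, Pi.single_apply]
      rw [this, hx', map_sum, map_sum]
      refine Finset.sum_congr rfl fun i _ => ?_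
      rw [map_smul, map_smul, smul_eq_mul, smul_eq_mul, mul_comm]
    have hball : ∀ x : X, ‖x‖ ≤ ‖z‖ → ‖x' x‖ ≤ b := by
      intro x hx
      obtain ⟨c, hc, hcx⟩ : ∃ c : ℂ, ‖c‖ = 1 ∧ c * x' x = ‖x' x‖ := by
        obtain ⟨c, hc, h⟩ := RCLike.exists_norm_eq_mul_self (x' x)
        exact ⟨c, hc, h.symm⟩
      have := (hg (T (c • x)) (subset_closure ⟨c • x, by simpa [norm_smul, hc] using hx, rfl⟩)).le
      have e : g (T (c • x)) = ‖x' x‖ := by rw [← hcx, map_smul, map_smul]; rfl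
      rw [e] at this
      simpa using this
    have hb0 : 0 ≤ b := (norm_nonneg _).trans (hball 0 (norm_zero.trans_le (norm_nonneg z)))
    have hnorm : ‖z‖ * ‖x'‖ ≤ b := by
      rcases eq_or_lt_of_le (norm_nonneg z) with h | h
      · rw [← h, zero_mul]; exact hb0
      · rw [mul_comm, ← le_div_iff₀ h]
        refine ContinuousLinearMap.opNorm_le_of_unit_norm (by positivity) fun x hx => ?_
        have := hball ((‖z‖ : ℂ) • x) (by
          rw [norm_smul, hx, mul_one, Complex.norm_real, Real.norm_of_nonneg (norm_nonneg z)])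
        rw [map_smul, norm_smul, Complex.norm_real,
          Real.norm_of_nonneg (norm_nonneg z)] at this
        rwa [le_div_iff₀ h, mul_comm]
    have h1 : b < RCLike.re (g w) := hb
    rw [hgw] at h1
    have h2 : RCLike.re (z x') ≤ ‖z x'‖ := RCLike.re_le_norm _
    have h3 := z.le_opNorm x'
    linarith
  obtain ⟨_, ⟨x, hx, rfl⟩, hd⟩ := Metric.mem_closure_iff.1 hK ε hε
  refine ⟨x, by simpa using hx, fun x' hx' => ?_⟩
  rw [dist_comm, dist_pi_lt_iff hε] at hd
  simpa [dist_eq_norm, T, w] using hd ⟨x', hx'⟩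

end General

open EllOne

/-- The quadratic form `signForm` precomposed with a diagonal operator, on the unit ball. -/
def quad (u : ℕ → ℂ) (hu : ∀ j, ‖u j‖ ≤ 1) : Au EllOne :=
  have hball : ∀ x : unitBall EllOne, ‖diag u hu x‖ ≤ 1 := fun x =>
    (norm_diag_le hu _).trans (mem_ball_zero_iff.1 x.2).le
  have hlip : LipschitzWith 2
      fun x : unitBall EllOne => signForm (diag u hu x) (diag u hu x) :=
    LipschitzWith.of_dist_le_mul fun x y => by
      rw [dist_eq_norm, Subtype.dist_eq, dist_eq_norm]
      refine (norm_signForm_self_sub_le _ _ (hball x) (hball y)).trans ?_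
      rw [← map_sub]
      exact mul_le_mul_of_nonneg_left (norm_diag_le hu _) zero_le_two
  ⟨BoundedContinuousFunction.ofNormedAddCommGroup _ hlip.continuous 1 fun x =>
      (norm_signForm_le _ _).trans (mul_le_one₀ (hball x) (norm_nonneg _) (hball x)),
    hlip.uniformContinuous, fun x => signForm (diag u hu x) (diag u hu x), fun x _ =>
      ((signForm.analyticAt_bilinear _).comp₂ ((diag u hu).analyticAt x) ((diag u hu).analyticAt x)),
    fun _ => rfl⟩

theorem quad_apply (u : ℕ → ℂ) (hu : ∀ j, ‖u j‖ ≤ 1) (x : unitBall EllOne) :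
    quad u hu x = signForm (diag u hu x) (diag u hu x) := rfl

/-! ### Counting nonprincipal ultrafilters on ℕ. -/

section Ultrafilters

open Classical in
/-- The `S`-th member of the standard independent family on the countable set of pairs
`(F, 𝓕)`, where `F` is a finite set of naturals and `𝓕` a finite family of such sets. -/
def independentSet (S : Set ℕ) : Set (Finset ℕ × Finset (Finset ℕ)) :=
  {p | p.1.filter (· ∈ S) ∈ p.2}

theorem exists_finset_filter_injOn (I : Finset (Set ℕ)) :
    ∃ F : Finset ℕ, ∀ S ∈ I, ∀ T ∈ I, (∀ n ∈ F, n ∈ S ↔ n ∈ T) → S = T := by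
  classical
  have h : ∀ p : Set ℕ × Set ℕ, ∃ n, (n ∈ p.1 ↔ n ∈ p.2) → p.1 = p.2 := by
    intro p
    by_contra! hp
    exact (hp 0).2 (Set.ext fun n => (hp n).1)
  choose n hn using h
  exact ⟨(I ×ˢ I).image n, fun S hS T hT hF => hn (S, T)
    (hF _ (Finset.mem_image_of_mem n (Finset.mk_mem_product hS hT)))⟩

theorem exists_ultrafilter_independentSet (T : Set (Set ℕ)) :
    ∃ U : Ultrafilter (Finset ℕ × Finset (Finset ℕ)), ∀ S, independentSet S ∈ U ↔ S ∈ T := by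
  classical
  let g : Set ℕ → Set (Finset ℕ × Finset (Finset ℕ)) := fun S =>
    if S ∈ T then independentSet S else (independentSet S)ᶜ
  have hg : NeBot (generate (Set.range g)) := by
    rw [generate_neBot_iff]
    intro t ht hfin
    lift t to Finset (Set (Finset ℕ × Finset (Finset ℕ))) using hfin
    rw [← Set.image_univ, Finset.subset_set_image_iff] at ht
    obtain ⟨I, -, rfl⟩ := ht
    obtain ⟨F, hF⟩ := exists_finset_filter_injOn I
    -- F separates the members of I, so the trace on F of a set outside T is not the trace of any
    -- member of I in T.
    refine ⟨(F, (I.filter (· ∈ T)).image fun S => F.filter (· ∈ S)), ?_⟩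
    simp only [Finset.coe_image, Set.mem_sInter, Set.forall_mem_image]
    intro S hS
    by_cases hST : S ∈ T
    · simp only [g, if_pos hST, independentSet, Set.mem_ofPred_eq]
      exact Finset.mem_image_of_mem _ (Finset.mem_filter.2 ⟨hS, hST⟩)
    · simp only [g, if_neg hST, independentSet, Set.mem_compl_iff, Set.mem_ofPred_eq]
      intro hmem
      obtain ⟨S', hS', he⟩ := Finset.mem_image.1 hmem
      obtain ⟨hS'I, hS'T⟩ := Finset.mem_filter.1 hS'
      refine hST (hF S' hS'I S hS (fun n hn => ?_) ▸ hS'T)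
      have := Finset.ext_iff.1 he n
      simpa [hn] using this
  refine ⟨Ultrafilter.of (generate (Set.range g)), fun S => ?_⟩
  have hS : g S ∈ Ultrafilter.of (generate (Set.range g)) :=
    Ultrafilter.of_le _ (mem_generate_of_mem ⟨S, rfl⟩)
  by_cases hST : S ∈ T
  · simpa [g, hST] using hS
  · simpa [g, hST, Ultrafilter.compl_mem_iff_notMem] using hS

theorem two_power_continuum_le_mk_ultrafilter :
    2 ^ Cardinal.continuum ≤ Cardinal.mk (Ultrafilter ℕ) := by
  choose U hU using exists_ultrafilter_independentSet
  obtain ⟨e⟩ : Nonempty (Finset ℕ × Finset (Finset ℕ) ≃ ℕ) := nonempty_equiv_of_countable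
  have hinj : Function.Injective fun T => (U T).map e := by
    intro T T' h
    have h' : U T = U T' := by
      have := congrArg (Ultrafilter.map e.symm) h
      simpa [Ultrafilter.map_map] using this
    ext S
    rw [← hU T S, h', hU T' S]
  simpa using Cardinal.mk_le_of_injective hinj

theorem two_power_continuum_le_mk_nonprincipal :
    2 ^ Cardinal.continuum ≤ Cardinal.mk {U : Ultrafilter ℕ // (U : Filter ℕ) ≤ cofinite} := by
  have h2 : Cardinal.aleph0 < 2 ^ Cardinal.continuum :=
    Cardinal.aleph0_lt_continuum.trans (Cardinal.cantor _)
  have hinf : Infinite (Ultrafilter ℕ) :=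
    Cardinal.infinite_iff.2 (h2.le.trans two_power_continuum_le_mk_ultrafilter)
  have hc : Cardinal.mk (Set.range (pure : ℕ → Ultrafilter ℕ)) < Cardinal.mk (Ultrafilter ℕ) :=
    (Cardinal.le_aleph0_iff_set_countable.2 (Set.countable_range _)).trans_lt
      (h2.trans_le two_power_continuum_le_mk_ultrafilter)
  refine two_power_continuum_le_mk_ultrafilter.trans ?_
  rw [← Cardinal.mk_compl_of_infinite _ hc]
  refine Cardinal.mk_subtype_mono fun U hU => ?_
  rcases U.le_cofinite_or_eq_pure with h | ⟨n, rfl⟩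
  · exact h
  · exact absurd ⟨n, rfl⟩ hU

end Ultrafilters

/-! ### Splitting infinite sets; an almost sharp monomial bound. -/

theorem _root_.Set.Infinite.exists_split {s : Set ℕ} (hs : s.Infinite) :
    ∃ t u : Set ℕ, t ⊆ s ∧ u ⊆ s ∧ Disjoint t u ∧ t.Infinite ∧ u.Infinite := by
  obtain ⟨t, u, rfl, hd, hc⟩ := hs.exists_union_disjoint_cardinal_eq_of_infinite
  have key : t.Infinite ↔ u.Infinite := by
    rw [← Set.infinite_coe_iff, ← Set.infinite_coe_iff, Cardinal.infinite_iff,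
      Cardinal.infinite_iff, hc]
  have : t.Infinite ∧ u.Infinite := by
    rcases Set.infinite_union.1 hs with h | h
    · exact ⟨h, key.1 h⟩
    · exact ⟨key.2 h, h⟩
  exact ⟨t, u, Set.subset_union_left, Set.subset_union_right, hd, this⟩

/-- On a + b = 1 the monomial peaks where a : b = k : 2l, and r : (1 - r) is nearly that ratio. The
error in k must be small absolutely, not just relative to l, which Dirichlet approximation provides.
-/
theorem exists_monomial_bound {r ε : ℝ} (hr : 0 ≤ r) (hr1 : r < 1) (hε : 0 < ε) :
    ∃ k l : ℕ, 0 < l ∧ 0 < r ^ k ∧ ∀ a b : ℝ, 0 ≤ a → 0 ≤ b → a + b ≤ 1 →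
      a ^ k * b ^ (2 * l) ≤ (1 + ε) * (r ^ k * (1 - r) ^ (2 * l)) := by
  rcases hr.eq_or_lt with rfl | hr0
  -- For r = 0 the condition 0 < r ^ k forces k = 0.
  · refine ⟨0, 1, one_pos, by simp, fun a b ha hb hab => ?_⟩
    have : b ^ 2 ≤ 1 := pow_le_one₀ hb (by linarith)
    simp only [pow_zero, sub_zero, one_pow, mul_one, one_mul]
    linarith
  have hs : 0 < 1 - r := by linarith
  have hlog : 0 < Real.log (1 + ε) := Real.log_pos (by linarith)
  obtain ⟨n, hn⟩ := exists_nat_gt (1 / (r * Real.log (1 + ε)))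
  obtain ⟨j, l, hl, hln, hjl⟩ := Real.exists_int_int_abs_mul_sub_le (2 * r / (1 - r)) (Nat.succ_pos n)
  have hδ : |(l : ℝ) * (2 * r / (1 - r)) - j| ≤ r * Real.log (1 + ε) := by
    refine hjl.trans ?_
    rw [div_lt_iff₀ (by positivity)] at hn
    rw [div_le_iff₀ (by positivity)]
    push_cast
    nlinarith [mul_pos hr0 hlog]
  have hj : 0 ≤ j := by
    have h1 : 1 / ((n.succ : ℝ) + 1) < 1 := by
      rw [div_lt_one (by positivity)]; push_cast; linarith [(n.cast_nonneg : (0 : ℝ) ≤ n)]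
    have h2 := (abs_le.1 hjl).2
    have h3 : (0 : ℝ) ≤ l * (2 * r / (1 - r)) :=
      mul_nonneg (by exact_mod_cast hl.le) (by positivity)
    have : (-1 : ℝ) < j := by linarith
    have : (-1 : ℤ) < j := by exact_mod_cast this
    omega
  lift j to ℕ using hj
  lift l to ℕ using hl.le
  refine ⟨j, l, by exact_mod_cast hl, by positivity, fun a b ha hb hab => ?_⟩
  push_cast at hδ
  have e1 : (a / r) ^ j ≤ Real.exp (j * (a / r - 1)) := by
    rw [Real.exp_nat_mul]
    exact pow_le_pow_left₀ (by positivity) (by linarith [Real.add_one_le_exp (a / r - 1)]) _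
  have e2 : (b / (1 - r)) ^ (2 * l) ≤ Real.exp ((2 * l : ℕ) * (b / (1 - r) - 1)) := by
    rw [Real.exp_nat_mul]
    exact pow_le_pow_left₀ (by positivity) (by linarith [Real.add_one_le_exp (b / (1 - r) - 1)]) _
  have e3 : j * (a / r - 1) + (2 * l : ℕ) * (b / (1 - r) - 1) ≤ Real.log (1 + ε) := by
    have h1 : b / (1 - r) - 1 ≤ (r - a) / (1 - r) := by
      rw [div_sub_one hs.ne']
      exact div_le_div_of_nonneg_right (by linarith) hs.le
    have h2 : j * (a / r - 1) + (2 * l : ℕ) * (b / (1 - r) - 1)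
        ≤ j * (a / r - 1) + (2 * l : ℕ) * ((r - a) / (1 - r)) := by gcongr
    -- The exponent is the Dirichlet error times (r - a)/r, and |r - a| ≤ 1.
    have h3 : j * (a / r - 1) + (2 * l : ℕ) * ((r - a) / (1 - r))
        = (r - a) / r * (l * (2 * r / (1 - r)) - j) := by
      push_cast; field_simp; ring
    have h4 : |(r - a) / r * ((l : ℝ) * (2 * r / (1 - r)) - j)| ≤ 1 / r * (r * Real.log (1 + ε)) := by
      rw [abs_mul]
      gcongr
      rw [abs_div, abs_of_pos hr0]
      gcongr
      rw [abs_le]; constructor <;> linarith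
    have h5 : 1 / r * (r * Real.log (1 + ε)) = Real.log (1 + ε) := by field_simp
    linarith [le_abs_self ((r - a) / r * ((l : ℝ) * (2 * r / (1 - r)) - j))]
  have e4 : (a / r) ^ j * (b / (1 - r)) ^ (2 * l) ≤ 1 + ε := by
    calc (a / r) ^ j * (b / (1 - r)) ^ (2 * l)
        ≤ Real.exp (j * (a / r - 1)) * Real.exp ((2 * l : ℕ) * (b / (1 - r) - 1)) := by gcongr
      _ ≤ Real.exp (Real.log (1 + ε)) := by rw [← Real.exp_add]; exact Real.exp_le_exp.2 e3
      _ = 1 + ε := Real.exp_log (by linarith)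
  have e5 : a ^ j * b ^ (2 * l)
      = (a / r) ^ j * (b / (1 - r)) ^ (2 * l) * (r ^ j * (1 - r) ^ (2 * l)) := by
    rw [div_pow, div_pow]; field_simp
  rw [e5]
  gcongr

/-! ### A subsequence of coordinates whose tails carry little mass of z. -/

namespace EllOne

theorem norm_indicator_one_le (S : Set ℕ) (j : ℕ) : ‖S.indicator (1 : ℕ → ℂ) j‖ ≤ 1 := by
  by_cases h : j ∈ S <;> simp [h]

/-- The projection of `ℓ₁` onto the coordinates in `S`. -/
def restr (S : Set ℕ) : EllOne →L[ℂ] EllOne :=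
  diag (S.indicator 1) (norm_indicator_one_le S)

theorem restr_restr {S T : Set ℕ} (h : S ⊆ T) (x : EllOne) : restr S (restr T x) = restr S x := by
  ext j
  by_cases hS : j ∈ S
  · simp [restr, hS, h hS]
  · simp [restr, hS]

theorem restr_add_restr_compl (S : Set ℕ) (x : EllOne) : restr S x + restr Sᶜ x = x := by
  ext j
  by_cases hS : j ∈ S <;> simp [restr, hS]

theorem norm_restr_add_norm_restr_le {S T : Set ℕ} (h : Disjoint S T) (x : EllOne) :
    ‖restr S x‖ + ‖restr T x‖ ≤ ‖x‖ := by
  refine norm_diag_add_norm_diag_le _ _ (fun j => ?_) x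
  by_cases hS : j ∈ S
  · simp [hS, Set.disjoint_left.1 h hS]
  · simpa [hS] using norm_indicator_one_le T j

theorem norm_restr_le (S : Set ℕ) (x : EllOne) : ‖restr S x‖ ≤ ‖x‖ := norm_diag_le _ x

theorem norm_comp_restr_le {x' : StrongDual ℂ EllOne} (hx' : ‖x'‖ ≤ 1) (S : Set ℕ) :
    ‖x'.comp (restr S)‖ ≤ 1 :=
  ContinuousLinearMap.opNorm_le_bound _ zero_le_one fun x =>
    x'.le_of_opNorm_le_of_le hx' (norm_restr_le S x)

end EllOne

/-- `ε` bounds the variation on `S` of the finitely additive measure given by `z`. -/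
def VariationLE (z : StrongDual ℂ (StrongDual ℂ EllOne)) (S : Set ℕ) (ε : ℝ) : Prop :=
  ∀ x' : StrongDual ℂ EllOne, ‖x'‖ ≤ 1 → ‖z (x'.comp (restr S))‖ ≤ ε

namespace VariationLE

variable {z : StrongDual ℂ (StrongDual ℂ EllOne)} {S T U : Set ℕ} {ε : ℝ}

theorem univ : VariationLE z Set.univ ‖z‖ := fun _ hx' =>
  z.le_of_opNorm_le_of_le le_rfl (norm_comp_restr_le hx' _) |>.trans_eq (mul_one _)

theorem mono (h : VariationLE z T ε) (hST : S ⊆ T) : VariationLE z S ε := by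
  intro x' hx'
  have : x'.comp (restr S) = (x'.comp (restr S)).comp (restr T) := by
    ext x; exact congrArg x' (restr_restr hST x).symm
  rw [this]
  exact h _ (norm_comp_restr_le hx' S)

/-- If both halves exceeded ε / 2, two almost norming functionals, rotated to make their values
positive, would add up to one of norm at most 1, because T and U are disjoint. -/
theorem half_or_half (h : VariationLE z S ε) (hT : T ⊆ S) (hU : U ⊆ S) (hTU : Disjoint T U) :
    VariationLE z T (ε / 2) ∨ VariationLE z U (ε / 2) := by
  by_contra! hcon
  simp only [VariationLE, not_forall, not_le] at hcon
  obtain ⟨⟨x, hx, hxε⟩, ⟨y, hy, hyε⟩⟩ := hcon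
  obtain ⟨c, hc, hcx⟩ := RCLike.exists_norm_eq_mul_self (z (x.comp (restr T)))
  obtain ⟨d, hd, hdy⟩ := RCLike.exists_norm_eq_mul_self (z (y.comp (restr U)))
  let w : StrongDual ℂ EllOne := c • x.comp (restr T) + d • y.comp (restr U)
  have hw : ‖w‖ ≤ 1 := by
    refine ContinuousLinearMap.opNorm_le_bound _ zero_le_one fun p => ?_
    have h1 : ‖w p‖ ≤ ‖c * x (restr T p)‖ + ‖d * y (restr U p)‖ := norm_add_le _ _
    rw [norm_mul, norm_mul, hc, hd, one_mul, one_mul] at h1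
    have h2 := x.le_of_opNorm_le_of_le hx (le_refl ‖restr T p‖)
    have h3 := y.le_of_opNorm_le_of_le hy (le_refl ‖restr U p‖)
    linarith [norm_restr_add_norm_restr_le hTU p]
  have hwS : w.comp (restr S) = w := by
    ext p
    change c * x (restr T (restr S p)) + d * y (restr U (restr S p)) = _
    rw [restr_restr hT, restr_restr hU]
    rfl
  have hzw : z w = ((‖z (x.comp (restr T))‖ + ‖z (y.comp (restr U))‖ : ℝ) : ℂ) := by
    rw [map_add, map_smul, map_smul, smul_eq_mul, smul_eq_mul, ← hcx, ← hdy]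
    push_cast
    rfl
  have := h w hw
  rw [hwS, hzw, Complex.norm_real] at this
  linarith [(le_abs_self _).trans this]

end VariationLE

theorem exists_strictMono_variationLE (z : StrongDual ℂ (StrongDual ℂ EllOne)) :
    ∃ a : ℕ → ℕ, StrictMono a ∧ ∀ ε > 0, ∃ i, VariationLE z (a '' Set.Ici i) ε := by
  let P : ℕ → Type := fun n => {A : Set ℕ // A.Infinite ∧ VariationLE z A (‖z‖ / 2 ^ n)}
  have step : ∀ n (A : P n), ∃ B : P (n + 1), B.1 ⊆ A.1 := by
    rintro n ⟨A, hA, hv⟩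
    obtain ⟨t, u, ht, hu, hd, hti, hui⟩ := hA.exists_split
    have e : ‖z‖ / 2 ^ n / 2 = ‖z‖ / 2 ^ (n + 1) := by rw [pow_succ, div_div]
    rcases hv.half_or_half ht hu hd with h | h
    · exact ⟨⟨t, hti, e ▸ h⟩, ht⟩
    · exact ⟨⟨u, hui, e ▸ h⟩, hu⟩
  choose g hg using step
  let A : ∀ n, P n := fun n => Nat.rec
    ⟨Set.univ, Set.infinite_univ, by simpa using VariationLE.univ⟩ (fun n A => g n A) n
  have hanti : Antitone fun n => (A n).1 := antitone_nat_of_succ_le fun n => hg n (A n)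
  -- Diagonal choice: a n lies in the n-th set of a decreasing chain, so the tail from i lies in the
  -- i-th set.
  obtain ⟨a, ha, haA⟩ := extraction_forall_of_frequently (P := fun n k => k ∈ (A n).1)
    fun n => Nat.frequently_atTop_iff_infinite.2 (A n).2.1
  refine ⟨a, ha, fun ε hε => ?_⟩
  obtain ⟨i, hi⟩ := pow_unbounded_of_one_lt (‖z‖ / ε) (one_lt_two (α := ℝ))
  refine ⟨i, fun x' hx' => ((A i).2.2.mono ?_ x' hx').trans ?_⟩
  · rintro _ ⟨n, hn, rfl⟩
    exact hanti hn (haA n)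
  · rw [div_lt_iff₀ hε] at hi
    rw [div_le_iff₀ (by positivity)]
    linarith

/-! ### Construction of the characters in the fiber. -/

theorem exists_net_tendsto {X : Type*} [NormedAddCommGroup X] [NormedSpace ℂ X]
    (z : StrongDual ℂ (StrongDual ℂ X)) :
    ∃ p : Finset (StrongDual ℂ X) × ℕ → X, (∀ i, ‖p i‖ ≤ ‖z‖) ∧
      ∀ x' : StrongDual ℂ X, Tendsto (fun i => x' (p i)) atTop (𝓝 (z x')) := by
  classical
  choose p hp hpz using fun i : Finset (StrongDual ℂ X) × ℕ =>
    exists_forall_norm_sub_lt z i.1 (Nat.one_div_pos_of_nat (α := ℝ) (n := i.2))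
  refine ⟨p, hp, fun x' => ?_⟩
  rw [Metric.tendsto_atTop]
  intro ε hε
  obtain ⟨n, hn⟩ := exists_nat_one_div_lt hε
  refine ⟨({x'}, n), fun i hi => ?_⟩
  rw [dist_eq_norm]
  refine (hpz i x' (hi.1 (Finset.mem_singleton_self x'))).trans (lt_of_le_of_lt ?_ hn)
  exact Nat.one_div_le_one_div hi.2

theorem neBot_prod_self_inf_ne {U : Ultrafilter ℕ} (hU : (U : Filter ℕ) ≤ cofinite) :
    NeBot ((U : Filter ℕ) ×ˢ (U : Filter ℕ) ⊓ 𝓟 {p | p.1 ≠ p.2}) := by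
  rw [inf_principal_neBot_iff]
  intro s hs
  obtain ⟨A, hA, B, hB, hAB⟩ := mem_prod_iff.1 hs
  have hinf : (A ∩ B).Infinite := fun hfin =>
    compl_notMem (f := (U : Filter ℕ)) (inter_mem hA hB) (hU hfin.compl_mem_cofinite)
  obtain ⟨m, hm⟩ := hinf.nonempty
  obtain ⟨n, hn, hne⟩ := hinf.exists_notMem_finset {m}
  exact ⟨(m, n), hAB ⟨hm.1, hn.2⟩, fun h => hne (by simpa using h.symm)⟩

theorem norm_smul_unitVec_sub_le (c : ℂ) (m n : ℕ) :
    ‖(c / 2) • (unitVec m - unitVec n)‖ ≤ ‖c‖ := by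
  rw [norm_smul, norm_div, Complex.norm_ofNat]
  have := norm_sub_le (unitVec m) (unitVec n)
  rw [norm_unitVec, norm_unitVec] at this
  nlinarith [norm_nonneg c]

theorem norm_signForm_diag_sub_le {u : ℕ → ℂ} (hu : ∀ j, ‖u j‖ ≤ 1) {m n : ℕ} (hmn : m ≠ n)
    {c : ℂ} (hm : u m = c) (hn : u n = c) (x : EllOne) (t : ℂ) (ht : ‖t‖ ≤ 1)
    (hx : ‖x + (t / 2) • (unitVec m - unitVec n)‖ ≤ 1) :
    ‖signForm (diag u hu (x + (t / 2) • (unitVec m - unitVec n)))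
        (diag u hu (x + (t / 2) • (unitVec m - unitVec n))) - (t * c) ^ 2‖
      ≤ 2 * ‖diag u hu x‖ := by
  have h1 : diag u hu ((t / 2) • (unitVec m - unitVec n))
      = ((t * c) / 2) • (unitVec m - unitVec n) := by
    rw [map_smul, map_sub, diag_unitVec, diag_unitVec, hm, hn, ← smul_sub, smul_smul]
    congr 1; ring
  have h2 : signForm (((t * c) / 2) • (unitVec m - unitVec n))
      (((t * c) / 2) • (unitVec m - unitVec n)) = (t * c) ^ 2 := by
    rw [map_smul, map_smul, smul_apply, signForm_unitVec_sub hmn, smul_eq_mul,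
      smul_eq_mul]
    ring
  have hc : ‖c‖ ≤ 1 := hm ▸ hu m
  have h3 : ‖t * c‖ ≤ 1 := by
    rw [norm_mul]; exact mul_le_one₀ ht (norm_nonneg _) hc
  rw [← h2]
  refine (norm_signForm_self_sub_le _ _ ((norm_diag_le hu _).trans hx)
    ((norm_smul_unitVec_sub_le _ _ _).trans h3)).trans ?_
  rw [map_add, h1, add_sub_cancel_right]

/-- The values of `φ` at the forms `quad u` whose diagonal operators are eventually constant along
`U` on the coordinates `a n`. -/
def QuadEstimate (z : StrongDual ℂ (StrongDual ℂ EllOne)) (a : ℕ → ℕ) (U : Ultrafilter ℕ)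
    (φ : Spectrum EllOne) : Prop :=
  ∀ (u v : ℕ → ℂ) (hu : ∀ j, ‖u j‖ ≤ 1) (hv : ∀ j, ‖v j‖ ≤ 1) (c : ℂ)
    (x' : StrongDual ℂ EllOne), (∀ j, ‖u j‖ + ‖v j‖ ≤ 1) → (∀ᶠ n in U, u (a n) = c) →
    ‖x'‖ ≤ 1 →
    ‖φ (quad u hu) - (((1 - ‖z‖ : ℝ) : ℂ) * c) ^ 2‖ ≤ 2 * (‖z‖ - ‖z (x'.comp (diag v hv))‖)

theorem exists_mem_fiber_quadEstimate (z : StrongDual ℂ (StrongDual ℂ EllOne)) (hz : ‖z‖ < 1)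
    {a : ℕ → ℕ} (ha : Function.Injective a) {U : Ultrafilter ℕ} (hU : (U : Filter ℕ) ≤ cofinite) :
    ∃ φ ∈ fiber z, QuadEstimate z a U φ := by
  obtain ⟨p, hp, hpz⟩ := exists_net_tendsto z
  have hne := neBot_prod_self_inf_ne hU
  -- The factor n/(n+1) keeps the points in the open ball while t tends to 1 - ‖z‖.
  let t : ℕ → ℝ := fun n => (1 - ‖z‖) * ((n : ℝ) / (n + 1))
  have ht0 : ∀ n, 0 ≤ t n := fun n => mul_nonneg (by linarith) (by positivity)
  have ht1 : ∀ n, t n < 1 - ‖z‖ := fun n => by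
    refine mul_lt_of_lt_one_right (by linarith) ?_
    rw [div_lt_one (by positivity)]; linarith
  have htnorm : ∀ n, ‖(t n : ℂ)‖ = t n := fun n => by
    rw [Complex.norm_real, Real.norm_of_nonneg (ht0 n)]
  have htz : ∀ n, t n ≤ 1 := fun n => by linarith [ht1 n, norm_nonneg z]
  let y : (Finset (StrongDual ℂ EllOne) × ℕ) × (ℕ × ℕ) → unitBall EllOne := fun i =>
    ⟨p i.1 + ((t i.2.1 : ℂ) / 2) • (unitVec (a i.2.1) - unitVec (a i.2.2)), by
      rw [mem_ball_zero_iff]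
      have h1 := norm_smul_unitVec_sub_le (t i.2.1 : ℂ) (a i.2.1) (a i.2.2)
      rw [htnorm] at h1
      linarith [norm_add_le (p i.1) (((t i.2.1 : ℂ) / 2) • (unitVec (a i.2.1) - unitVec (a i.2.2))),
        hp i.1, ht1 i.2.1]⟩
  let F : Filter ((Finset (StrongDual ℂ EllOne) × ℕ) × (ℕ × ℕ)) :=
    atTop ×ˢ ((U : Filter ℕ) ×ˢ (U : Filter ℕ) ⊓ 𝓟 {p | p.1 ≠ p.2})
  have hF : F.NeBot := by classical exact atTop_neBot.prod hne
  let W := Ultrafilter.of F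
  have hW : (W : Filter _) ≤ F := Ultrafilter.of_le F
  have t1 : Tendsto (fun i : (Finset (StrongDual ℂ EllOne) × ℕ) × (ℕ × ℕ) => i.1) W atTop :=
    tendsto_fst.mono_left hW
  have t2 : Tendsto (fun i : (Finset (StrongDual ℂ EllOne) × ℕ) × (ℕ × ℕ) => i.2) W
      ((U : Filter ℕ) ×ˢ (U : Filter ℕ) ⊓ 𝓟 {p | p.1 ≠ p.2}) := tendsto_snd.mono_left hW
  have t3 : Tendsto (fun i : (Finset (StrongDual ℂ EllOne) × ℕ) × (ℕ × ℕ) => i.2.1) W U :=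
    tendsto_fst.comp (t2.mono_right inf_le_left)
  have t4 : Tendsto (fun i : (Finset (StrongDual ℂ EllOne) × ℕ) × (ℕ × ℕ) => i.2.2) W U :=
    tendsto_snd.comp (t2.mono_right inf_le_left)
  have hneW : ∀ᶠ i : (Finset (StrongDual ℂ EllOne) × ℕ) × (ℕ × ℕ) in W, i.2.1 ≠ i.2.2 :=
    t2.eventually (mem_inf_of_right (mem_principal_self _))
  have htU : Tendsto (fun n => (t n : ℂ)) U (𝓝 ((1 - ‖z‖ : ℝ) : ℂ)) := by
    have h1 : Tendsto (fun n : ℕ => (n : ℝ) / (n + 1)) U (𝓝 1) :=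
      (tendsto_natCast_div_add_atTop (1 : ℝ)).mono_left (Nat.cofinite_eq_atTop ▸ hU)
    have h2 := h1.const_mul (1 - ‖z‖)
    rw [mul_one] at h2
    exact (Complex.continuous_ofReal.tendsto _).comp h2
  obtain ⟨φ, hφ⟩ := exists_tendsto_of_ultrafilter W y
  refine ⟨φ, fun x' => ?_, fun u v hu hv c x' huv huc hx' => ?_⟩
  · refine tendsto_nhds_unique (hφ (ofDual x')) ?_
    -- Both x'(e_{a m}) and x'(e_{a n}) converge to the same limit L along U, so their difference
    -- vanishes in the limit.
    obtain ⟨L, -, hL⟩ := (isCompact_closedBall (0 : ℂ) ‖x'‖).ultrafilter_le_nhds'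
      (U.map fun n => x' (unitVec (a n))) (by
        refine Filter.mem_map.2 (Filter.univ_mem' fun n => ?_)
        rw [Set.mem_preimage, mem_closedBall_zero_iff]
        exact x'.le_of_opNorm_le_of_le le_rfl (norm_unitVec _).le |>.trans_eq (mul_one _))
    have hL : Tendsto (fun n => x' (unitVec (a n))) U (𝓝 L) := hL
    have h1 := ((hpz x').comp t1).add
      (((htU.comp t3).div_const 2).mul ((hL.comp t3).sub (hL.comp t4)))
    rw [sub_self, mul_zero, add_zero] at h1
    refine h1.congr fun i => ?_
    simp [y]
  · have h1 : Tendsto (fun i => ‖quad u hu (y i) - ((t i.2.1 : ℂ) * c) ^ 2‖) W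
        (𝓝 ‖φ (quad u hu) - (((1 - ‖z‖ : ℝ) : ℂ) * c) ^ 2‖) :=
      ((hφ (quad u hu)).sub (((htU.comp t3).mul_const c).pow 2)).norm
    have h2 : Tendsto (fun i : (Finset (StrongDual ℂ EllOne) × ℕ) × (ℕ × ℕ) =>
        2 * (‖z‖ - ‖x'.comp (diag v hv) (p i.1)‖)) W
        (𝓝 (2 * (‖z‖ - ‖z (x'.comp (diag v hv))‖))) :=
      ((((hpz _).comp t1).norm).const_sub ‖z‖).const_mul 2
    refine le_of_tendsto_of_tendsto h1 h2 ?_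
    filter_upwards [hneW, t3.eventually huc, t4.eventually huc] with i hi hi1 hi2
    rw [quad_apply]
    refine (norm_signForm_diag_sub_le hu (ha.ne hi) hi1 hi2 _ _
      ((htnorm _).trans_le (htz _)) (mem_ball_zero_iff.1 (y i).2).le).trans ?_
    -- The error ‖diag u p‖ is at most ‖p‖ - ‖diag v p‖, hence at most ‖z‖ - |x'(diag v p)|.
    have h3 := norm_diag_add_norm_diag_le hu hv huv (p i.1)
    have h4 := x'.le_of_opNorm_le_of_le hx' (le_refl ‖diag v hv (p i.1)‖)
    have h5 : ‖x'.comp (diag v hv) (p i.1)‖ ≤ 1 * ‖diag v hv (p i.1)‖ := h4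
    linarith [hp i.1]

/-! ### Characters of distinct ultrafilters are at distance 2. -/

theorem exists_norm_one_pow_eq_neg_one {l : ℕ} (hl : 0 < l) :
    ∃ η : ℂ, ‖η‖ = 1 ∧ η ^ (2 * l) = -1 := by
  refine ⟨Complex.exp ((Real.pi / (2 * l) : ℝ) * Complex.I), Complex.norm_exp_ofReal_mul_I _, ?_⟩
  rw [← Complex.exp_nat_mul, ← Complex.exp_pi_mul_I]
  congr 1
  have : (l : ℂ) ≠ 0 := by exact_mod_cast hl.ne'
  push_cast
  field_simp

theorem norm_ofDual_comp_diag_pow_mul_quad_pow_le {u v : ℕ → ℂ} (hu : ∀ j, ‖u j‖ ≤ 1)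
    (hv : ∀ j, ‖v j‖ ≤ 1) (huv : ∀ j, ‖u j‖ + ‖v j‖ ≤ 1) {x' : StrongDual ℂ EllOne}
    (hx' : ‖x'‖ ≤ 1) {k l : ℕ} {M : ℝ} (hM : ∀ a b : ℝ, 0 ≤ a → 0 ≤ b → a + b ≤ 1 →
      a ^ k * b ^ (2 * l) ≤ M) :
    ‖ofDual (x'.comp (diag v hv)) ^ k * quad u hu ^ l‖ ≤ M := by
  have hM0 : 0 ≤ M := (by positivity : (0 : ℝ) ≤ 0 ^ k * 0 ^ (2 * l)).trans
    (hM 0 0 le_rfl le_rfl (by norm_num))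
  refine Au.norm_le hM0 fun y => ?_
  rw [Au.mul_apply, Au.pow_apply, Au.pow_apply, ofDual_apply, quad_apply, norm_mul, norm_pow,
    norm_pow]
  have h1 : ‖x'.comp (diag v hv) y‖ ≤ ‖diag v hv y‖ :=
    (x'.le_of_opNorm_le_of_le hx' (le_refl ‖diag v hv y‖)).trans_eq (one_mul _)
  have h2 := norm_signForm_le (diag u hu y) (diag u hu y)
  have h3 := norm_diag_add_norm_diag_le hu hv huv (y : EllOne)
  have h4 := mem_ball_zero_iff.1 y.2
  calc ‖x'.comp (diag v hv) y‖ ^ k * ‖signForm (diag u hu y) (diag u hu y)‖ ^ l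
      ≤ ‖diag v hv y‖ ^ k * (‖diag u hu y‖ * ‖diag u hu y‖) ^ l := by gcongr
    _ = ‖diag v hv y‖ ^ k * ‖diag u hu y‖ ^ (2 * l) := by rw [← sq, pow_mul]
    _ ≤ M := hM _ _ (norm_nonneg _) (norm_nonneg _) (by linarith)

theorem two_le_norm_sub {z : StrongDual ℂ (StrongDual ℂ EllOne)} (hz : ‖z‖ < 1) {a : ℕ → ℕ}
    (ha : Function.Injective a) (hvar : ∀ ε > 0, ∃ i, VariationLE z (a '' Set.Ici i) ε)
    {U V : Ultrafilter ℕ} (hU : (U : Filter ℕ) ≤ cofinite) (hV : (V : Filter ℕ) ≤ cofinite)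
    (hUV : U ≠ V) {φ ψ : Spectrum EllOne} (hφz : φ ∈ fiber z) (hψz : ψ ∈ fiber z)
    (hφ : QuadEstimate z a U φ)
    (hψ : QuadEstimate z a V ψ) :
    2 ≤ ‖WeakDual.CharacterSpace.toCLM φ - WeakDual.CharacterSpace.toCLM ψ‖ := by
  classical
  set D := ‖WeakDual.CharacterSpace.toCLM φ - WeakDual.CharacterSpace.toCLM ψ‖ with hD
  have hD0 : 0 ≤ D := norm_nonneg _
  set s : ℝ := 1 - ‖z‖ with hs
  have hs0 : 0 < s := by linarith
  obtain ⟨A, hAU, hAV⟩ : ∃ A ∈ U, A ∉ V := by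
    by_contra! h
    exact hUV (Ultrafilter.coe_le_coe.1 fun A hA => h A hA).symm
  suffices h : ∀ ε > 0, 2 ≤ D * (1 + ε) by
    by_contra! hlt
    have := h ((2 - D) / 4) (by linarith)
    nlinarith
  intro ε hε
  obtain ⟨k, l, hl, hrk, hM⟩ := exists_monomial_bound (norm_nonneg z) hz hε
  obtain ⟨η, hη, hηl⟩ := exists_norm_one_pow_eq_neg_one hl
  have key : ∀ δ > 0, ∃ (q : Au EllOne) (w : ℝ), ‖z‖ - δ ≤ w ∧ w ≤ ‖z‖ ∧
      ‖φ q - (s : ℂ) ^ 2‖ ≤ 2 * δ ∧ ‖ψ q - ((s : ℂ) * η) ^ 2‖ ≤ 2 * δ ∧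
      w ^ k * ‖φ q ^ l - ψ q ^ l‖ ≤ D * ((1 + ε) * (‖z‖ ^ k * s ^ (2 * l))) := by
    intro δ hδ
    -- Half of δ pays for the mass of z on the tail, the other half for x falling short of norming
    -- z.
    obtain ⟨i, hi⟩ := hvar (δ / 2) (by linarith)
    obtain ⟨x, hx1, hxδ⟩ := z.exists_lt_apply_of_lt_opNorm (r := ‖z‖ - δ / 2) (by linarith)
    let S : Set ℕ := a '' Set.Ici i
    let v : ℕ → ℂ := Sᶜ.indicator 1
    -- The weight u is 1 along U and η along V, and lives on the tail; v lives on its complement.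
    let u : ℕ → ℂ := fun j => if j ∈ S then (if j ∈ a '' A then 1 else η) else 0
    have hv : ∀ j, ‖v j‖ ≤ 1 := norm_indicator_one_le _
    have huv : ∀ j, ‖u j‖ + ‖v j‖ ≤ 1 := by
      intro j
      by_cases hS : j ∈ S
      · by_cases hA : j ∈ a '' A <;> simp only [u, if_pos hS, if_pos, hA] <;>
          simp [v, hS, hη]
      · simp [u, v, hS]
    have hu : ∀ j, ‖u j‖ ≤ 1 := fun j => by linarith [huv j, norm_nonneg (v j)]
    have hSa : ∀ n, i ≤ n → a n ∈ S := fun n hn => ⟨n, hn, rfl⟩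
    have huU : ∀ᶠ n in U, u (a n) = 1 := by
      have h1 : ∀ᶠ n in U, i ≤ n := (Nat.cofinite_eq_atTop ▸ hU) (eventually_ge_atTop i)
      filter_upwards [h1, hAU] with n hn hnA
      simp only [u, if_pos (hSa n hn), if_pos (Set.mem_image_of_mem a hnA)]
    have huV : ∀ᶠ n in V, u (a n) = η := by
      have h1 : ∀ᶠ n in V, i ≤ n := (Nat.cofinite_eq_atTop ▸ hV) (eventually_ge_atTop i)
      filter_upwards [h1, Ultrafilter.compl_mem_iff_notMem.2 hAV] with n hn hnA
      have : a n ∉ a '' A := fun h => hnA (ha.mem_set_image.1 h)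
      simp only [u, if_pos (hSa n hn), if_neg this]
    have hzx : z x = z (x.comp (restr S)) + z (x.comp (diag v hv)) := by
      rw [← map_add]
      congr 1
      ext p
      change x p = x (restr S p) + x (restr Sᶜ p)
      rw [← map_add, restr_add_restr_compl]
    have hw1 : ‖z‖ - δ ≤ ‖z (x.comp (diag v hv))‖ := by
      have h1 := norm_add_le (z (x.comp (restr S))) (z (x.comp (diag v hv)))
      rw [← hzx] at h1
      linarith [hi x hx1.le]
    have hw2 : ‖z (x.comp (diag v hv))‖ ≤ ‖z‖ :=
      (z.le_of_opNorm_le_of_le le_rfl (norm_comp_restr_le hx1.le Sᶜ)).trans_eq (mul_one _)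
    have h1 := hφ u v hu hv 1 x huv huU hx1.le
    have h2 := hψ u v hu hv η x huv huV hx1.le
    rw [mul_one] at h1
    refine ⟨quad u hu, _, hw1, hw2, h1.trans (by linarith), h2.trans (by linarith), ?_⟩
    have h3 := norm_ofDual_comp_diag_pow_mul_quad_pow_le hu hv huv hx1.le hM
    have h4 := (WeakDual.CharacterSpace.toCLM φ - WeakDual.CharacterSpace.toCLM ψ).le_of_opNorm_le_of_le
      hD.ge h3
    refine le_trans (le_of_eq ?_) h4
    rw [sub_apply, WeakDual.CharacterSpace.coe_toCLM, WeakDual.CharacterSpace.coe_toCLM, map_mul,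
      map_mul, map_pow, map_pow, map_pow, map_pow, hφz, hψz, ← mul_sub, norm_mul, norm_pow]
  choose! q w hw1 hw2 hqφ hqψ hbound using key
  let δ : ℕ → ℝ := fun n => 1 / ((n : ℝ) + 1)
  have hδ0 : ∀ n, 0 < δ n := fun n => Nat.one_div_pos_of_nat
  have hδ : Tendsto δ atTop (𝓝 0) := tendsto_one_div_add_atTop_nhds_zero_nat
  have hδ2 : Tendsto (fun n => 2 * δ n) atTop (𝓝 0) := by simpa using hδ.const_mul 2
  have tw : Tendsto (fun n => w (δ n)) atTop (𝓝 ‖z‖) := by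
    refine tendsto_of_tendsto_of_tendsto_of_le_of_le ?_ tendsto_const_nhds
      (fun n => hw1 _ (hδ0 n)) (fun n => hw2 _ (hδ0 n))
    simpa using hδ.const_sub ‖z‖
  have tφ : Tendsto (fun n => φ (q (δ n))) atTop (𝓝 ((s : ℂ) ^ 2)) :=
    tendsto_iff_norm_sub_tendsto_zero.2 <| squeeze_zero (fun _ => norm_nonneg _)
      (fun n => hqφ _ (hδ0 n)) hδ2
  have tψ : Tendsto (fun n => ψ (q (δ n))) atTop (𝓝 (((s : ℂ) * η) ^ 2)) :=
    tendsto_iff_norm_sub_tendsto_zero.2 <| squeeze_zero (fun _ => norm_nonneg _)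
      (fun n => hqψ _ (hδ0 n)) hδ2
  -- The exponents k, l and the root η do not depend on δ, so δ → 0 is taken with them fixed.
  have hlim := le_of_tendsto' ((tw.pow k).mul ((tφ.pow l).sub (tψ.pow l)).norm)
    fun n => hbound _ (hδ0 n)
  have e : ‖((s : ℂ) ^ 2) ^ l - (((s : ℂ) * η) ^ 2) ^ l‖ = 2 * s ^ (2 * l) := by
    rw [← pow_mul, ← pow_mul, mul_pow, hηl, mul_neg_one, sub_neg_eq_add, ← two_mul, norm_mul,
      norm_pow, Complex.norm_real, Real.norm_of_nonneg hs0.le, Complex.norm_ofNat]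
  rw [e] at hlim
  have hpos : 0 < ‖z‖ ^ k * s ^ (2 * l) := mul_pos hrk (pow_pos hs0 _)
  nlinarith

/-! ### The two cardinal bounds. -/

theorem two_power_continuum_le_mk_gleasonParts
    (z : StrongDual ℂ (StrongDual ℂ EllOne)) (hz : ‖z‖ < 1) :
    2 ^ Cardinal.continuum ≤ Cardinal.mk {G : Set (Spectrum EllOne) //
      G ∈ gleasonParts EllOne ∧ (G ∩ fiber z).Nonempty} := by
  obtain ⟨a, ha, hvar⟩ := exists_strictMono_variationLE z
  choose φ hφz hφ using fun U : {U : Ultrafilter ℕ // (U : Filter ℕ) ≤ cofinite} =>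
    exists_mem_fiber_quadEstimate z hz ha.injective U.2
  have hself : ∀ U, φ U ∈ gleasonPart (φ U) := fun U => by
    simp [gleasonPart]
  refine two_power_continuum_le_mk_nonprincipal.trans (Cardinal.mk_le_of_injective
    (f := fun U => ⟨gleasonPart (φ U), ⟨φ U, rfl⟩, φ U, hself U, hφz U⟩) fun U V h => ?_)
  by_contra hne
  have hUV : gleasonPart (φ U) = gleasonPart (φ V) := Subtype.ext_iff.1 h
  have hmem : φ V ∈ gleasonPart (φ U) := hUV ▸ hself V
  exact absurd hmem (not_lt.2 (two_le_norm_sub hz ha.injective hvar U.2 V.2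
    (fun h => hne (Subtype.ext h)) (hφz U) (hφz V) (hφ U) (hφ V)))

theorem mk_gleasonParts_le {X : Type} [NormedAddCommGroup X] [NormedSpace ℂ X]
    [TopologicalSpace.SeparableSpace X] (P : Set (Spectrum X) → Prop) :
    Cardinal.mk {G : Set (Spectrum X) // G ∈ gleasonParts X ∧ P G} ≤ 2 ^ Cardinal.continuum :=
  (Cardinal.mk_subtype_mono fun _ hG => hG.1).trans (Cardinal.mk_range_le.trans mk_spectrum_le)

end BallAlgebra

end

theorem mainTheorem2
    (z : StrongDual ℂ (StrongDual ℂ BallAlgebra.EllOne)) (hz : ‖z‖ < 1) :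
    Cardinal.mk {G : Set (BallAlgebra.Spectrum BallAlgebra.EllOne) //
        G ∈ BallAlgebra.gleasonParts BallAlgebra.EllOne ∧
        (G ∩ BallAlgebra.fiber z).Nonempty} =
      2 ^ Cardinal.continuum :=
  le_antisymm (BallAlgebra.mk_gleasonParts_le _)
    (BallAlgebra.two_power_continuum_le_mk_gleasonParts z hz)
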